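/- **Car park.** For $n,m\in\mathbb N_0$, let $m$ drivers arrive one after the other at a linear car park with spaces $1,\dots,n$, each having chosen a favourite space. A driver parks in the first free space whose number is at least that of the chosen space, and leaves if there is none. For $k\in\mathbb Z$ let $\mathrm{cp}(n,m,k)$ be the number of the $n^m$ assignments (choices of favourite spaces) for which exactly $k$ drivers leave; in particular $\mathrm{cp}(n,m,k)=0$ for $k<0$. In a random assignment all $n^m$ assignments are equally likely. Let $m\colon\mathbb N\to\mathbb N$. The probability that in a random assignment of $m(n)$ drivers to $n$ spaces all spaces are occupied in the end is $\mathrm{cp}(n,m(n),m(n)-n)/n^{m(n)}$, and $$\lim_{n\to\infty}\frac{\mathrm{cp}(n,m(n),m(n)-n)}{n^{m(n)}}=\begin{cases}0&\text{if }\lim_{n\to\infty}m(n)/n\text{ exists and is}\le 1,\\ 1&\text{if }\lim_{n\to\infty}m(n)/n=\infty.\end{cases}$$ **Coupon collector.** Let there be $n$ items of strictly decreasing value. A collector acquires items one at a time, independently and uniformly at random. Whenever she acquires an item that she already possesses, she trades the duplicate for the most valuable item among those of lower value that she does not yet possess, if there is one. Then for every $f\colon\mathbb N\to\mathbb N$ with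 $\lim_{n\to\infty}f(n)=\infty$, the probability that her collection is complete after she has acquired $n\cdot f(n)$ items tends to $1$ as $n\to\infty$. -/

import Mathlib

open Filter Topology

namespace CarPark

/-- One driver, whose favourite space is `c`, arrives at a linear car park with `n` spaces.
The state consists of the set of occupied spaces and of the number of drivers who have left
so far. The driver takes the first free space at or after `c`, and leaves if there is none. -/
def arrive {n : ℕ} (s : Finset (Fin n) × ℕ) (c : Fin n) : Finset (Fin n) × ℕ :=
  if h : (Finset.univ.filter fun j : Fin n => c ≤ j ∧ j ∉ s.1).Nonempty then
    (insert ((Finset.univ.filter fun j : Fin n => c ≤ j ∧ j ∉ s.1).min' h) s.1, s.2)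
  else (s.1, s.2 + 1)

/-- The state after the drivers `0, 1, …, m - 1`, driver `i` having chosen space `f i`, have
arrived one after the other at the empty car park. -/
def finalState {n m : ℕ} (f : Fin m → Fin n) : Finset (Fin n) × ℕ :=
  (List.ofFn f).foldl arrive (∅, 0)

/-- The set of spaces that are occupied in the end. -/
def occupied {n m : ℕ} (f : Fin m → Fin n) : Finset (Fin n) := (finalState f).1

/-- The number of drivers who fail to park. -/
def defect {n m : ℕ} (f : Fin m → Fin n) : ℕ := (finalState f).2

/-- The number of assignments of `m` drivers to `n` spaces with exactly `k` drivers failing to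
park; it is `0` for negative `k`. -/
def cp (n m : ℕ) (k : ℤ) : ℕ :=
  (Finset.univ.filter fun f : Fin m → Fin n => (defect f : ℤ) = k).card

/-- The probability that all `n` spaces are occupied in the end, when each of the `n ^ m`
assignments of `m` drivers to `n` spaces is equally likely. -/
noncomputable def fullProb (n m : ℕ) : ℝ :=
  ((Finset.univ.filter fun f : Fin m → Fin n => occupied f = Finset.univ).card : ℝ) / (n : ℝ) ^ m

/-- The items of smaller value than `c` that are not in the collection `held`. -/
noncomputable def wanted {n : ℕ} (v : Fin n → ℝ) (held : Finset (Fin n)) (c : Fin n) :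
    Finset (Fin n) :=
  Finset.univ.filter fun j : Fin n => v j < v c ∧ j ∉ held

/-- A collector of `n` items with values `v` acquires the item `c`. If she does not possess it,
she keeps it. Otherwise she trades the duplicate for the most valuable item among those that are
of smaller value than `c` and that she does not possess, if there are any. -/
noncomputable def acquire {n : ℕ} (v : Fin n → ℝ) (held : Finset (Fin n)) (c : Fin n) :
    Finset (Fin n) :=
  if c ∉ held then insert c held
  else if h : (wanted v held c).Nonempty then
    insert (Finset.exists_max_image (wanted v held c) v h).choose held
  else held

/-- The set of items possessed after acquiring the items `f 0, f 1, …, f (m - 1)` in turn. -/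
noncomputable def collection {n m : ℕ} (v : Fin n → ℝ) (f : Fin m → Fin n) : Finset (Fin n) :=
  (List.ofFn f).foldl (acquire v) ∅

/-- The probability that the trading collector has a complete collection after acquiring `m`
items, each of the `n ^ m` sequences of items being equally likely. -/
noncomputable def completeProb (n m : ℕ) (v : Fin n → ℝ) : ℝ :=
  ((Finset.univ.filter fun f : Fin m → Fin n => collection v f = Finset.univ).card : ℝ) /
    (n : ℝ) ^ m

end CarPark

/-!
Everything rests on a criterion for a full car park (`occupied_eq_univ_iff`): all spaces are
occupied in the end if and only if, for each `i ≤ n`, at least `i` drivers prefer one of the first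
`i` spaces. The number of drivers who leave is `m` minus the number of occupied spaces, so a full
car park is the same as `m - n` drivers leaving. When the values of the items decrease, the trading
collector fills her collection exactly as the drivers fill the car park, so the coupon collector
with `n * f n` items is the case `m n / n = f n → ∞` of the car park.

If `m / n → ∞`, the number of drivers who prefer one of the first `i` spaces is binomial with mean
`i * m / n`. An exponential Markov inequality bounds the probability that it is less than `i` by
`q ^ i`, where `q = 2 * exp (-m / (2 * n)) → 0` (`card_favouring_lt_le`), and the sum over `i ≥ 1`
of these bounds tends to `0`.

If `m / n → L ≤ 1`, the car park cannot be full unless `m ≥ n`, so the delicate case is that of `m`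
slightly above `n`. Call an assignment strictly full if, for each `i ≥ 1`, more than `i` drivers
prefer one of the first `i` spaces. By a cycle lemma, at most `m - n` of the `n` rotations of an
assignment are strictly full (`card_strictlyFull_sub_le`), so a random assignment is strictly full
with probability at most `(m - n) / n`. A full assignment becomes strictly full when one more
driver, who prefers the first space, is inserted at any of `m + 1` positions. Hence `(m + 1) / n`
times the probability of a full car park is at most the expectation, over assignments of `m + 1`
drivers, of the number `N` of drivers who prefer the first space, restricted to strictly full
assignments (`mul_card_full_le`). Since `N ≤ K + (2 / K) * 2 ^ N` and the expectation of `2 ^ N` is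
at most `exp ((m + 1) / n)`, this is at most
`K * (m + 1 - n) / n + (2 / K) * exp ((m + 1) / n)` (`fullProb_le`), which is small when first `K`
and then `n` is large.
-/

namespace CarPark

open Finset

/-! ### A criterion for a full car park -/

/-- The number of drivers whose favourite space is one of the first `i` spaces. -/
def favouring {n m : ℕ} (f : Fin m → Fin n) (i : ℕ) : ℕ :=
  (univ.filter fun d : Fin m => (f d : ℕ) < i).card

lemma arrive_of_exists {n : ℕ} (s : Finset (Fin n) × ℕ) (c : Fin n)
    (h : ∃ j, c ≤ j ∧ j ∉ s.1) :
    ∃ j, c ≤ j ∧ j ∉ s.1 ∧ (∀ k, c ≤ k → k ∉ s.1 → j ≤ k) ∧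
      arrive s c = (insert j s.1, s.2) := by
  have hne : (univ.filter fun j : Fin n => c ≤ j ∧ j ∉ s.1).Nonempty := by
    obtain ⟨j, hj⟩ := h
    exact ⟨j, by simpa using hj⟩
  have hmem := Finset.min'_mem _ hne
  rw [mem_filter] at hmem
  exact ⟨_, hmem.2.1, hmem.2.2, fun k hk hk' => Finset.min'_le _ _ (by simp [hk, hk']),
    by rw [arrive, dif_pos hne]⟩

lemma arrive_of_not_exists {n : ℕ} (s : Finset (Fin n) × ℕ) (c : Fin n)
    (h : ¬ ∃ j, c ≤ j ∧ j ∉ s.1) : arrive s c = (s.1, s.2 + 1) := by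
  rw [arrive, dif_neg]
  rintro ⟨j, hj⟩
  exact h ⟨j, by simpa using hj⟩

lemma card_add_foldl_arrive {n : ℕ} (l : List (Fin n)) (s : Finset (Fin n) × ℕ) :
    (l.foldl arrive s).1.card + (l.foldl arrive s).2 = s.1.card + s.2 + l.length := by
  induction l generalizing s with
  | nil => simp
  | cons c l ih =>
    rw [List.foldl_cons, ih, List.length_cons]
    by_cases h : ∃ j, c ≤ j ∧ j ∉ s.1
    · obtain ⟨j, -, hj, -, hs⟩ := arrive_of_exists s c h
      rw [hs, card_insert_of_notMem hj]
      dsimp only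
      omega
    · rw [arrive_of_not_exists s c h]
      dsimp only
      omega

lemma subset_foldl_arrive {n : ℕ} (l : List (Fin n)) (s : Finset (Fin n) × ℕ) :
    s.1 ⊆ (l.foldl arrive s).1 := by
  induction l generalizing s with
  | nil => simp
  | cons c l ih =>
    refine Subset.trans ?_ (ih _)
    by_cases h : ∃ j, c ≤ j ∧ j ∉ s.1
    · obtain ⟨j, -, -, -, hs⟩ := arrive_of_exists s c h
      simp [hs]
    · simp [arrive_of_not_exists s c h]

/-- Each of the first `i` spaces that gets occupied is taken by a driver who prefers one of the
first `i` spaces. -/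
lemma card_filter_foldl_arrive_le {n : ℕ} (i : ℕ) (l : List (Fin n))
    (s : Finset (Fin n) × ℕ) :
    ((l.foldl arrive s).1.filter fun j : Fin n => (j : ℕ) < i).card ≤
      (s.1.filter fun j : Fin n => (j : ℕ) < i).card + l.countP fun c : Fin n => (c : ℕ) < i := by
  induction l generalizing s with
  | nil => simp
  | cons c l ih =>
    rw [List.foldl_cons, List.countP_cons]
    refine (ih _).trans ?_
    by_cases h : ∃ j, c ≤ j ∧ j ∉ s.1
    · obtain ⟨j, hcj, hj, -, hs⟩ := arrive_of_exists s c h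
      rw [hs, filter_insert]
      by_cases hi : (j : ℕ) < i
      · have hc : (c : ℕ) < i := lt_of_le_of_lt hcj hi
        have := card_insert_le j (s.1.filter fun j : Fin n => (j : ℕ) < i)
        simp only [hi, hc, if_true, decide_true]
        omega
      · rw [if_neg hi]
        omega
    · rw [arrive_of_not_exists s c h]
      dsimp only
      omega

/-- While the space `j` is free, each driver who prefers a space up to `j` finds a free one
before `j`. -/
lemma countP_le_card_filter_foldl_arrive {n : ℕ} (j : Fin n) (l : List (Fin n))
    (s : Finset (Fin n) × ℕ) (hj : j ∉ (l.foldl arrive s).1) :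
    (s.1.filter fun k : Fin n => k < j).card + (l.countP fun c : Fin n => (c : ℕ) < j + 1) ≤
      ((l.foldl arrive s).1.filter fun k : Fin n => k < j).card := by
  induction l generalizing s with
  | nil => simp
  | cons c l ih =>
    rw [List.foldl_cons] at hj ⊢
    refine le_trans ?_ (ih _ hj)
    have hj' : j ∉ (arrive s c).1 := fun h => hj (subset_foldl_arrive l _ h)
    rw [List.countP_cons]
    by_cases h : ∃ j, c ≤ j ∧ j ∉ s.1
    · obtain ⟨k, hck, hk, hmin, hs⟩ := arrive_of_exists s c h
      rw [hs] at hj' ⊢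
      simp only [mem_insert, not_or] at hj'
      dsimp only
      rw [filter_insert]
      by_cases hc : (c : ℕ) < j + 1
      · have hkj : k < j :=
          lt_of_le_of_ne (hmin j (Fin.le_def.2 (by omega)) hj'.2) (Ne.symm hj'.1)
        rw [if_pos hkj, card_insert_of_notMem (by simp [hk])]
        simp only [hc, decide_true, if_true]
        omega
      · simp only [hc, decide_false, Bool.false_eq_true, if_false]
        split_ifs
        · have := card_le_card (subset_insert k (s.1.filter fun k : Fin n => k < j))
          omega
        · omega
    · rw [arrive_of_not_exists s c h] at hj' ⊢
      have hc : ¬ (c : ℕ) < j + 1 := fun hc => h ⟨j, Fin.le_def.2 (by omega), hj'⟩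
      simp [hc]

lemma countP_ofFn_eq_favouring {n m : ℕ} (f : Fin m → Fin n) (i : ℕ) :
    ((List.ofFn f).countP fun c : Fin n => (c : ℕ) < i) = favouring f i := by
  induction m with
  | zero => simp [favouring]
  | succ m ih =>
    rw [List.ofFn_succ, List.countP_cons, ih, favouring, favouring, card_filter, card_filter,
      Fin.sum_univ_succ, add_comm]
    simp

/-- All spaces are occupied in the end if and only if, for each `i`, at least `i` drivers prefer
one of the first `i` spaces. -/
theorem occupied_eq_univ_iff {n m : ℕ} (f : Fin m → Fin n) :
    occupied f = univ ↔ ∀ i ≤ n, i ≤ favouring f i := by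
  constructor
  · intro h i hi
    have key := card_filter_foldl_arrive_le i (List.ofFn f) (∅, 0)
    rw [countP_ofFn_eq_favouring] at key
    change ((occupied f).filter fun j : Fin n => (j : ℕ) < i).card ≤ _ at key
    rw [h, Fin.card_filter_val_lt] at key
    simpa [hi] using key
  · intro h
    refine eq_univ_iff_forall.2 fun j => ?_
    by_contra hj
    have key := countP_le_card_filter_foldl_arrive j (List.ofFn f) (∅, 0) hj
    rw [countP_ofFn_eq_favouring] at key
    have h1 := h (j + 1) j.2
    have h2 : (((List.ofFn f).foldl arrive (∅, 0)).1.filter fun k : Fin n => k < j).card ≤ j := by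
      refine (card_le_card fun k hk => mem_Iio.2 (mem_filter.1 hk).2).trans ?_
      rw [Fin.card_Iio]
    omega

lemma card_occupied_add_defect {n m : ℕ} (f : Fin m → Fin n) :
    (occupied f).card + defect f = m := by
  simpa [occupied, defect, finalState] using card_add_foldl_arrive (List.ofFn f) (∅, 0)

theorem fullProb_eq_cp_div (n m : ℕ) :
    fullProb n m = (cp n m ((m : ℤ) - (n : ℤ)) : ℝ) / (n : ℝ) ^ m := by
  rw [fullProb, cp]
  congr 3
  ext f
  simp only [mem_filter, mem_univ, true_and]
  rw [← Finset.card_eq_iff_eq_univ, Fintype.card_fin]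
  have := card_occupied_add_defect f
  omega

/-! ### The trading coupon collector -/

/-- With values in decreasing order, acquiring an item is the arrival of a driver. -/
lemma acquire_eq_arrive {n : ℕ} {v : Fin n → ℝ} (hv : StrictAnti v)
    (s : Finset (Fin n) × ℕ) (c : Fin n) : acquire v s.1 c = (arrive s c).1 := by
  rw [acquire]
  by_cases hc : c ∈ s.1
  · rw [if_neg (not_not.2 hc)]
    by_cases h : ∃ j, c ≤ j ∧ j ∉ s.1
    · obtain ⟨j, hcj, hj, hmin, hs⟩ := arrive_of_exists s c h
      have hne : j ≠ c := fun h => hj (h ▸ hc)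
      have hjw : j ∈ wanted v s.1 c := by
        simp [wanted, hj, hv.lt_iff_gt, lt_of_le_of_ne hcj hne.symm]
      rw [dif_pos ⟨j, hjw⟩, hs]
      obtain ⟨h1, h2⟩ := (exists_max_image (wanted v s.1 c) v ⟨j, hjw⟩).choose_spec
      set k := (exists_max_image (wanted v s.1 c) v ⟨j, hjw⟩).choose
      simp only [wanted, mem_filter, mem_univ, true_and, hv.lt_iff_gt] at h1
      rw [le_antisymm (hv.le_iff_ge.1 (h2 j hjw)) (hmin k h1.1.le h1.2)]
    · rw [arrive_of_not_exists s c h, dif_neg]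
      rintro ⟨j, hj⟩
      simp only [wanted, mem_filter, mem_univ, true_and, hv.lt_iff_gt] at hj
      exact h ⟨j, hj.1.le, hj.2⟩
  · rw [if_pos hc]
    obtain ⟨j, hcj, hj, hmin, hs⟩ := arrive_of_exists s c ⟨c, le_rfl, hc⟩
    rw [hs, le_antisymm hcj (hmin c le_rfl hc)]

lemma collection_eq_occupied {n m : ℕ} {v : Fin n → ℝ} (hv : StrictAnti v)
    (f : Fin m → Fin n) : collection v f = occupied f := by
  have key : ∀ (l : List (Fin n)) (s : Finset (Fin n) × ℕ),
      l.foldl (acquire v) s.1 = (l.foldl arrive s).1 := by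
    intro l
    induction l with
    | nil => intro s; rfl
    | cons c l ih => intro s; rw [List.foldl_cons, List.foldl_cons, acquire_eq_arrive hv, ih]
  exact key _ (∅, 0)

theorem completeProb_eq_fullProb {n : ℕ} (m : ℕ) {v : Fin n → ℝ} (hv : StrictAnti v) :
    completeProb n m v = fullProb n m := by
  simp only [completeProb, fullProb, collection_eq_occupied hv]

/-! ### Many drivers -/

/-- The generating function of the number of drivers who prefer one of the first `i` spaces:
each driver contributes the factor `n - i + i * t`. -/
lemma sum_pow_favouring {n : ℕ} (m : ℕ) {i : ℕ} (hi : i ≤ n) (t : ℝ) :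
    ∑ f : Fin m → Fin n, t ^ favouring f i = ((n : ℝ) - i + i * t) ^ m := by
  have h1 : ∀ f : Fin m → Fin n,
      t ^ favouring f i = ∏ d, if (f d : ℕ) < i then t else 1 := by
    intro f
    rw [favouring, prod_ite]
    simp
  have h2 : ∑ c : Fin n, (if (c : ℕ) < i then t else 1) = (n : ℝ) - i + i * t := by
    have h3 := card_filter_add_card_filter_not (s := (univ : Finset (Fin n)))
      (fun c : Fin n => (c : ℕ) < i)
    rw [Fin.card_filter_val_lt, min_eq_right hi, card_univ, Fintype.card_fin] at h3
    have h4 : (i : ℝ) + ((univ.filter fun c : Fin n => ¬ (c : ℕ) < i).card : ℝ) = n := by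
      exact_mod_cast h3
    rw [sum_ite, sum_const, sum_const, Fin.card_filter_val_lt, min_eq_right hi, nsmul_eq_mul,
      nsmul_eq_mul]
    linarith
  rw [sum_congr rfl fun f _ => h1 f, ← Fintype.piFinset_univ,
    sum_prod_piFinset univ fun (_ : Fin m) (c : Fin n) => if (c : ℕ) < i then t else 1]
  simp [h2]

/-- An exponential Markov inequality for the event that fewer than `i` drivers prefer one of the
first `i` spaces. -/
lemma card_favouring_lt_le {n : ℕ} (m : ℕ) {i : ℕ} (hn : 0 < n) (hi : i ≤ n) :
    ((univ.filter fun f : Fin m → Fin n => favouring f i < i).card : ℝ) ≤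
      n ^ m * (2 * Real.exp (-(m / n : ℝ) / 2)) ^ i := by
  have hn' : (0 : ℝ) < n := by exact_mod_cast hn
  have h1 : ((univ.filter fun f : Fin m → Fin n => favouring f i < i).card : ℝ) ≤
      ∑ f : Fin m → Fin n, 2 ^ i * (1 / 2 : ℝ) ^ favouring f i := by
    rw [card_filter, Nat.cast_sum]
    refine sum_le_sum fun f _ => ?_
    split_ifs with h
    · rw [one_div, inv_pow, ← div_eq_mul_inv, Nat.cast_one, one_le_div (by positivity)]
      exact pow_le_pow_right₀ (by norm_num) h.le
    · rw [Nat.cast_zero]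
      positivity
  refine h1.trans ?_
  rw [← mul_sum, sum_pow_favouring m hi, mul_pow, ← Real.exp_nat_mul]
  have h2 : (n : ℝ) - i + i * (1 / 2) ≤ n * Real.exp (-(i / n : ℝ) / 2) := by
    have := mul_le_mul_of_nonneg_left (Real.add_one_le_exp (-(i / n : ℝ) / 2)) hn'.le
    refine le_trans (le_of_eq ?_) this
    field_simp
    ring
  have h3 : (0 : ℝ) ≤ (n : ℝ) - i + i * (1 / 2) := by
    have : (i : ℝ) ≤ n := by exact_mod_cast hi
    have : (0 : ℝ) ≤ i := Nat.cast_nonneg i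
    linarith
  have h4 := pow_le_pow_left₀ h3 h2 m
  rw [mul_pow, ← Real.exp_nat_mul] at h4
  have h5 : (m : ℝ) * (-(i / n : ℝ) / 2) = i * (-(m / n : ℝ) / 2) := by ring
  rw [h5] at h4
  calc _ ≤ 2 ^ i * ((n : ℝ) ^ m * Real.exp (i * (-(m / n : ℝ) / 2))) := by gcongr
    _ = _ := by ring

lemma fullProb_le_one (n m : ℕ) : fullProb n m ≤ 1 := by
  refine div_le_one_of_le₀ ?_ (by positivity)
  have := card_le_univ (univ.filter fun f : Fin m → Fin n => occupied f = univ)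
  rw [Fintype.card_fun, Fintype.card_fin, Fintype.card_fin] at this
  exact_mod_cast this

lemma fullProb_nonneg (n m : ℕ) : 0 ≤ fullProb n m := by
  rw [fullProb]
  positivity

/-- The union bound over the number of spaces that are preferred too rarely. -/
lemma one_sub_le_fullProb {n : ℕ} (m : ℕ) (hn : 0 < n)
    (hq : 2 * Real.exp (-(m / n : ℝ) / 2) ≤ 1 / 2) :
    1 - 2 * (2 * Real.exp (-(m / n : ℝ) / 2)) ≤ fullProb n m := by
  have hn' : (0 : ℝ) < n := by exact_mod_cast hn
  set q : ℝ := 2 * Real.exp (-(m / n : ℝ) / 2)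
  have hq0 : 0 ≤ q := by positivity
  have hsub : (univ.filter fun f : Fin m → Fin n => ¬ occupied f = univ) ⊆
      (Ico 1 (n + 1)).biUnion fun i => univ.filter fun f => favouring f i < i := by
    intro f hf
    rw [mem_filter, occupied_eq_univ_iff] at hf
    push Not at hf
    obtain ⟨-, i, hi, hlt⟩ := hf
    rw [mem_biUnion]
    exact ⟨i, by rw [mem_Ico]; omega, by simpa using hlt⟩
  have h1 : ((univ.filter fun f : Fin m → Fin n => ¬ occupied f = univ).card : ℝ) ≤
      n ^ m * (2 * q) := by
    calc _ ≤ ∑ i ∈ Ico 1 (n + 1),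
          ((univ.filter fun f : Fin m → Fin n => favouring f i < i).card : ℝ) := by
          exact_mod_cast (card_le_card hsub).trans card_biUnion_le
      _ ≤ ∑ i ∈ Ico 1 (n + 1), (n : ℝ) ^ m * q ^ i := by
          refine sum_le_sum fun i hi => card_favouring_lt_le m hn ?_
          rw [mem_Ico] at hi
          omega
      _ ≤ n ^ m * (2 * q) := by
          rw [← mul_sum]
          gcongr
          refine (geom_sum_Ico_le_of_lt_one hq0 (by linarith)).trans ?_
          rw [pow_one, div_le_iff₀ (by linarith)]
          nlinarith
  have h2 := card_filter_add_card_filter_not (s := (univ : Finset (Fin m → Fin n)))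
      (fun f => occupied f = univ)
  rw [card_univ, Fintype.card_fun, Fintype.card_fin, Fintype.card_fin] at h2
  have h3 : ((univ.filter fun f : Fin m → Fin n => occupied f = univ).card : ℝ) +
      ((univ.filter fun f : Fin m → Fin n => ¬ occupied f = univ).card : ℝ) = n ^ m := by
    exact_mod_cast h2
  rw [fullProb, le_div_iff₀ (by positivity)]
  linarith

theorem tendsto_fullProb_one {m : ℕ → ℕ}
    (hm : Tendsto (fun n : ℕ => (m n : ℝ) / (n : ℝ)) atTop atTop) :
    Tendsto (fun n : ℕ => fullProb n (m n)) atTop (𝓝 1) := by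
  have h1 : Tendsto (fun n : ℕ => 2 * Real.exp (-(m n / n : ℝ) / 2)) atTop (𝓝 0) := by
    have : Tendsto (fun n : ℕ => -(m n / n : ℝ) / 2) atTop atBot :=
      (tendsto_neg_atTop_atBot.comp hm).atBot_div_const (by norm_num)
    simpa using (Real.tendsto_exp_atBot.comp this).const_mul 2
  have h2 : Tendsto (fun n : ℕ => 1 - 2 * (2 * Real.exp (-(m n / n : ℝ) / 2))) atTop (𝓝 1) := by
    simpa using (h1.const_mul 2).const_sub 1
  refine tendsto_of_tendsto_of_tendsto_of_le_of_le' h2 tendsto_const_nhds ?_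
    (Eventually.of_forall fun n => fullProb_le_one n (m n))
  filter_upwards [eventually_gt_atTop 0, h1.eventually_le_const (by norm_num : (0 : ℝ) < 1 / 2)]
    with n hn hq
  exact one_sub_le_fullProb (m n) hn hq

/-! ### Strictly full assignments and the cycle lemma -/

/-- For each `i > 0`, more than `i` drivers prefer one of the first `i` spaces. -/
def StrictlyFull {n m : ℕ} (f : Fin m → Fin n) : Prop :=
  ∀ i, 0 < i → i ≤ n → i < favouring f i

/-- If two rotations of `f`, by `r < r'`, are strictly full, then more than `r' - r` and fewer
than `r' - r + (m - n)` drivers prefer a space in `[r, r')`: the second bound counts the drivers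
on the complementary arc. -/
lemma favouring_of_strictlyFull_sub {n m : ℕ} {f : Fin m → Fin n} {r r' : Fin n} (hr : r < r')
    (h : StrictlyFull fun d => f d - r) (h' : StrictlyFull fun d => f d - r') :
    favouring f r + r' < favouring f r' + r ∧
      favouring f r' + r + n < favouring f r + r' + m := by
  have hlt : (r : ℕ) < r' := hr
  have hr'n := r'.2
  have val_sub : ∀ a b : Fin n,
      ((a - b : Fin n) : ℕ) = if b ≤ a then (a : ℕ) - b else n + a - b := by
    intro a b
    split_ifs with hab
    · exact Fin.sub_val_of_le hab
    · exact Fin.coe_sub_iff_lt.2 (not_le.1 hab)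
  set A := univ.filter fun d : Fin m => (r : ℕ) ≤ f d ∧ (f d : ℕ) < r' with hA
  have e1 : favouring f r' = favouring f r + A.card := by
    rw [favouring, favouring, ← card_union_of_disjoint]
    · congr 1
      ext d
      simp only [hA, mem_filter, mem_univ, true_and, mem_union]
      omega
    · rw [disjoint_left]
      intro d
      simp only [hA, mem_filter, mem_univ, true_and]
      omega
  have e2 : (favouring fun d => f d - r) (r' - r) = A.card := by
    rw [favouring]
    congr 1
    ext d
    have := (f d).2
    simp only [hA, mem_filter, mem_univ, true_and, val_sub, Fin.le_def]
    split_ifs <;> omega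
  have e3 : (favouring fun d => f d - r') (n - (r' - r)) = Aᶜ.card := by
    rw [favouring]
    congr 1
    ext d
    have := (f d).2
    simp only [hA, mem_filter, mem_univ, true_and, val_sub, Fin.le_def, mem_compl]
    split_ifs <;> omega
  have h1 := h (r' - r) (by omega) (by omega)
  have h2 := h' (n - (r' - r)) (by omega) (by omega)
  have h3 := card_add_card_compl A
  rw [Fintype.card_fin] at h3
  rw [e2] at h1
  rw [e3] at h2
  omega

lemma lt_of_strictlyFull {n m : ℕ} (hn : 0 < n) {f : Fin m → Fin n} (h : StrictlyFull f) :
    n < m := by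
  refine (h n hn le_rfl).trans_le ?_
  simp [favouring]

open Classical in
/-- A cycle lemma: at most `m - n` rotations of an assignment are strictly full. -/
lemma card_strictlyFull_sub_le {n m : ℕ} (f : Fin m → Fin n) :
    (univ.filter fun r : Fin n => StrictlyFull fun d => f d - r).card ≤ m - n := by
  set S := univ.filter fun r : Fin n => StrictlyFull fun d => f d - r with hS
  have mem : ∀ r, r ∈ S ↔ StrictlyFull fun d => f d - r := by simp [hS]
  rcases S.eq_empty_or_nonempty with h0 | h0
  · simp [h0]
  obtain ⟨r₀, hr₀S, hmin⟩ := S.exists_min_image id h0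
  have hr₀ := (mem _).1 hr₀S
  have hnm : n < m := lt_of_strictlyFull r₀.pos hr₀
  -- The walk `favouring f r - r` is strictly increasing on `S`, and it stays within `m - n` of
  -- its value at the least element of `S`.
  have hcard : S.card ≤ (Ico ((favouring f r₀ : ℤ) - r₀)
      ((favouring f r₀ : ℤ) - r₀ + (m - n : ℤ))).card := by
    refine card_le_card_of_injOn (fun r : Fin n => (favouring f r : ℤ) - r) ?_ ?_
    · intro r hr
      rw [mem_coe] at hr
      rw [mem_coe, mem_Ico]
      dsimp only
      have hle : r₀ ≤ r := hmin r hr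
      rcases hle.eq_or_lt with h | h
      · rw [h]
        omega
      · have := favouring_of_strictlyFull_sub h hr₀ ((mem r).1 hr)
        omega
    · intro r hr r' hr' heq
      rw [mem_coe, mem] at hr hr'
      dsimp only at heq
      rcases lt_trichotomy r r' with h | h | h
      · have := favouring_of_strictlyFull_sub h hr hr'
        omega
      · exact h
      · have := favouring_of_strictlyFull_sub h hr' hr
        omega
  rw [Int.card_Ico] at hcard
  omega

open Classical in
/-- Averaging the cycle lemma over all assignments. -/
lemma mul_card_strictlyFull_le (n m : ℕ) :
    n * (univ.filter fun f : Fin m → Fin n => StrictlyFull f).card ≤ (m - n) * n ^ m := by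
  have h1 : ∀ r : Fin n, (univ.filter fun f : Fin m → Fin n => StrictlyFull f).card =
      (univ.filter fun f : Fin m → Fin n => StrictlyFull fun d => f d - r).card := by
    intro r
    have : NeZero n := ⟨r.pos.ne'⟩
    refine (card_equiv (Equiv.subRight fun _ : Fin m => r) fun f => ?_).symm
    simp only [mem_filter, mem_univ, true_and]
    rfl
  calc _ = ∑ _r : Fin n, (univ.filter fun f : Fin m → Fin n => StrictlyFull f).card := by simp
    _ = ∑ r : Fin n,
        (univ.filter fun f : Fin m → Fin n => StrictlyFull fun d => f d - r).card :=
      sum_congr rfl fun r _ => h1 r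
    _ = ∑ f : Fin m → Fin n,
        (univ.filter fun r : Fin n => StrictlyFull fun d => f d - r).card :=
      sum_card_bipartiteAbove_eq_sum_card_bipartiteBelow
        (fun (r : Fin n) (f : Fin m → Fin n) => StrictlyFull fun d => f d - r)
    _ ≤ ∑ _f : Fin m → Fin n, (m - n) := sum_le_sum fun f _ => card_strictlyFull_sub_le f
    _ = (m - n) * n ^ m := by simp [mul_comm]

open Classical in
/-- Inserting one more driver, who prefers the first space, at any of the `m + 1` positions turns
a full assignment into a strictly full one. -/
lemma mul_card_full_le {n : ℕ} (m : ℕ) (hn : 0 < n) :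
    (m + 1) * (univ.filter fun f : Fin m → Fin n => occupied f = univ).card ≤
      ∑ g ∈ univ.filter (fun g : Fin (m + 1) → Fin n => StrictlyFull g), favouring g 1 := by
  have h1 : ∀ d : Fin (m + 1), (univ.filter fun f : Fin m → Fin n => occupied f = univ).card ≤
      ((univ.filter fun g : Fin (m + 1) → Fin n => StrictlyFull g).filter
        fun g => (g d : ℕ) < 1).card := by
    intro d
    refine card_le_card_of_injOn (fun f => d.insertNth (α := fun _ => Fin n) ⟨0, hn⟩ f) ?_
      (Fin.insertNth_right_injective (α := fun _ => Fin n) _).injOn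
    intro f hf
    rw [mem_coe, mem_filter, occupied_eq_univ_iff] at hf
    rw [mem_coe, mem_filter, mem_filter]
    refine ⟨⟨mem_univ _, fun i hi hin => ?_⟩, by simp⟩
    have h2 := hf.2 i hin
    rw [favouring, card_filter] at h2
    rw [favouring, card_filter, Fin.sum_univ_succAbove _ d]
    simp only [Fin.insertNth_apply_same, Fin.insertNth_apply_succAbove, hi, if_true]
    omega
  calc _ = ∑ _d : Fin (m + 1),
        (univ.filter fun f : Fin m → Fin n => occupied f = univ).card := by simp
    _ ≤ _ := sum_le_sum fun d _ => h1 d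
    _ = ∑ g ∈ univ.filter (fun g : Fin (m + 1) → Fin n => StrictlyFull g), favouring g 1 :=
      sum_card_bipartiteAbove_eq_sum_card_bipartiteBelow
        (fun (d : Fin (m + 1)) (g : Fin (m + 1) → Fin n) => (g d : ℕ) < 1)

/-! ### About as many drivers as spaces, or fewer -/

lemma natCast_le_add_two_pow_div (N : ℕ) {K : ℝ} (hK : 0 < K) :
    (N : ℝ) ≤ K + 2 / K * 2 ^ N := by
  have h1 : (N : ℝ) ^ 2 ≤ 2 * 2 ^ N := by
    have : N ^ 2 ≤ 2 * 2 ^ N := by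
      rcases lt_or_ge N 4 with h | h
      · interval_cases N <;> norm_num
      · induction N, h using Nat.le_induction with
        | base => norm_num
        | succ k hk ih => rw [pow_succ 2]; nlinarith
    exact_mod_cast this
  have h2 : 2 / K * 2 ^ N = 2 * 2 ^ N / K := by ring
  rw [h2, ← sub_le_iff_le_add', le_div_iff₀ hK]
  nlinarith [sq_nonneg ((N : ℝ) - K)]

/-- The number `N` of drivers who prefer the first space satisfies `N ≤ K + 2 / K * 2 ^ N`. The
cycle lemma controls the contribution of `K`, the generating function that of `2 ^ N`. -/
lemma fullProb_le {n m : ℕ} (hn : 0 < n) (hm : n ≤ m) {K : ℝ} (hK : 0 < K) :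
    fullProb n m ≤ K * (m / n + 1 / n - 1) + 2 / K * Real.exp (m / n + 1 / n) := by
  classical
  have hn' : (0 : ℝ) < n := by exact_mod_cast hn
  set F : ℝ := ((univ.filter fun f : Fin m → Fin n => occupied f = univ).card : ℝ)
  set B := univ.filter fun g : Fin (m + 1) → Fin n => StrictlyFull g
  have hF : (m + 1) * F ≤ ∑ g ∈ B, (favouring g 1 : ℝ) := by
    have := mul_card_full_le m hn
    rw [← Nat.cast_le (α := ℝ)] at this
    push_cast at this
    convert this
  have hB : (n : ℝ) * B.card ≤ (m + 1 - n) * n ^ (m + 1) := by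
    have := mul_card_strictlyFull_le n (m + 1)
    have h : ((m + 1 - n : ℕ) : ℝ) = m + 1 - n := by
      rw [Nat.cast_sub (by omega)]
      push_cast
      ring
    rw [← h]
    exact_mod_cast this
  have hgen : ∑ g ∈ B, (2 : ℝ) ^ favouring g 1 ≤
      n ^ (m + 1) * Real.exp (m / n + 1 / n) := by
    refine (sum_le_sum_of_subset_of_nonneg (subset_univ B)
      fun _ _ _ => by positivity).trans ?_
    rw [sum_pow_favouring (m + 1) hn]
    have h2 : (n : ℝ) - (1 : ℕ) + (1 : ℕ) * 2 ≤ n * Real.exp (1 / n) := by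
      have := mul_le_mul_of_nonneg_left (Real.add_one_le_exp (1 / n : ℝ)) hn'.le
      refine le_trans (le_of_eq ?_) this
      push_cast
      field_simp
      ring
    refine (pow_le_pow_left₀ (by push_cast; linarith) h2 (m + 1)).trans (le_of_eq ?_)
    rw [mul_pow, ← Real.exp_nat_mul]
    congr 2
    push_cast
    ring
  have hsum : ∑ g ∈ B, (favouring g 1 : ℝ) ≤
      K * B.card + 2 / K * (n ^ (m + 1) * Real.exp (m / n + 1 / n)) := by
    calc _ ≤ ∑ g ∈ B, (K + 2 / K * 2 ^ favouring g 1) :=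
          sum_le_sum fun g _ => natCast_le_add_two_pow_div _ hK
      _ = K * B.card + 2 / K * ∑ g ∈ B, (2 : ℝ) ^ favouring g 1 := by
          rw [sum_add_distrib, ← mul_sum, sum_const, nsmul_eq_mul, mul_comm]
      _ ≤ _ := by gcongr
  have hF0 : 0 ≤ F := Nat.cast_nonneg _
  have hmn : (n : ℝ) ≤ m + 1 := by exact_mod_cast hm.trans (Nat.le_succ m)
  have hB' : (B.card : ℝ) ≤ n ^ (m + 1) * (m / n + 1 / n - 1) := by
    refine le_of_mul_le_mul_left (hB.trans (le_of_eq ?_)) hn'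
    field_simp
  have h3 : (n : ℝ) * F ≤ n * (n ^ m *
      (K * (m / n + 1 / n - 1) + 2 / K * Real.exp (m / n + 1 / n))) := by
    calc
      (n : ℝ) * F ≤ (m + 1) * F := by gcongr
      _ ≤ K * B.card + 2 / K * (n ^ (m + 1) * Real.exp (m / n + 1 / n)) := hF.trans hsum
      _ ≤ K * (n ^ (m + 1) * (m / n + 1 / n - 1)) +
          2 / K * (n ^ (m + 1) * Real.exp (m / n + 1 / n)) := by gcongr
      _ = _ := by ring
  rw [fullProb, div_le_iff₀ (by positivity), mul_comm]
  exact le_of_mul_le_mul_left h3 hn'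

lemma fullProb_eq_zero {n m : ℕ} (h : m < n) : fullProb n m = 0 := by
  rw [fullProb, filter_false_of_mem]
  · simp
  · intro f _ hf
    have := card_occupied_add_defect f
    rw [hf, card_univ, Fintype.card_fin] at this
    omega

theorem tendsto_fullProb_zero {m : ℕ → ℕ} {L : ℝ} (hL : L ≤ 1)
    (hm : Tendsto (fun n : ℕ => (m n : ℝ) / (n : ℝ)) atTop (𝓝 L)) :
    Tendsto (fun n : ℕ => fullProb n (m n)) atTop (𝓝 0) := by
  have hm' : Tendsto (fun n : ℕ => (m n : ℝ) / n + 1 / n) atTop (𝓝 L) := by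
    simpa using hm.add tendsto_one_div_atTop_nhds_zero_nat
  refine tendsto_order.2 ⟨fun a ha => Eventually.of_forall fun n =>
    ha.trans_le (fullProb_nonneg n (m n)), fun ε hε => ?_⟩
  -- With this choice of `K` the limit of the bound in `fullProb_le` is at most `ε / 2`.
  set K : ℝ := 4 * Real.exp L / ε with hKdef
  have hK : 0 < K := by positivity
  have h1 : Tendsto (fun n : ℕ => K * ((m n : ℝ) / n + 1 / n - 1) +
      2 / K * Real.exp ((m n : ℝ) / n + 1 / n)) atTop (𝓝 (K * (L - 1) + 2 / K * Real.exp L)) :=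
    ((hm'.sub_const 1).const_mul K).add (((Real.continuous_exp.tendsto L).comp hm').const_mul _)
  have h2 : K * (L - 1) + 2 / K * Real.exp L < ε := by
    have h3 : 2 / K * Real.exp L = ε / 2 := by
      rw [hKdef]
      field_simp
      norm_num
    have h4 : K * (L - 1) ≤ 0 := mul_nonpos_of_nonneg_of_nonpos hK.le (by linarith)
    linarith
  filter_upwards [eventually_gt_atTop 0, h1.eventually_lt_const h2] with n hn hlt
  rcases lt_or_ge (m n) n with h | h
  · rwa [fullProb_eq_zero h]
  · exact (fullProb_le hn h hK).trans_lt hlt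

end CarPark

theorem mainTheorem6 :
    (∀ m : ℕ → ℕ,
      (∀ n : ℕ, CarPark.fullProb n (m n) =
        (CarPark.cp n (m n) ((m n : ℤ) - (n : ℤ)) : ℝ) / (n : ℝ) ^ (m n)) ∧
      ((∃ L : ℝ, L ≤ 1 ∧ Tendsto (fun n : ℕ => (m n : ℝ) / (n : ℝ)) atTop (𝓝 L)) →
        Tendsto (fun n : ℕ => CarPark.fullProb n (m n)) atTop (𝓝 0)) ∧
      (Tendsto (fun n : ℕ => (m n : ℝ) / (n : ℝ)) atTop atTop →
        Tendsto (fun n : ℕ => CarPark.fullProb n (m n)) atTop (𝓝 1))) ∧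
    (∀ (v : (n : ℕ) → Fin n → ℝ) (f : ℕ → ℕ), (∀ n : ℕ, StrictAnti (v n)) →
      Tendsto f atTop atTop →
        Tendsto (fun n : ℕ => CarPark.completeProb n (n * f n) (v n)) atTop (𝓝 1)) := by
  refine ⟨fun m => ⟨fun n => CarPark.fullProb_eq_cp_div n (m n), ?_,
    CarPark.tendsto_fullProb_one⟩, fun v f hv hf => ?_⟩
  · rintro ⟨L, hL, hm⟩
    exact CarPark.tendsto_fullProb_zero hL hm
  · simp only [fun n => CarPark.completeProb_eq_fullProb (n * f n) (hv n)]
    refine CarPark.tendsto_fullProb_one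
      ((tendsto_natCast_atTop_atTop.comp hf).congr' ?_)
    filter_upwards [eventually_ne_atTop 0] with n hn
    have : (n : ℝ) ≠ 0 := by exact_mod_cast hn
    rw [Function.comp_apply, Nat.cast_mul, mul_div_cancel_left₀ _ this]
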